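/- Let $n\ge 0$ and let $B$ be a building set on $[n]=\{1,\dots,n\}$, i.e. a collection of nonempty subsets of $[n]$ that contains all singletons and is such that $I\cup J\in B$ whenever $I,J\in B$ and $I\cap J\neq\emptyset$ (it is not required that $[n]\in B$). Let $P_B=\sum_{I\in B}\mathrm{Conv}\{e_i\mid i\in I\}\subset\mathbb{R}^n$ (Minkowski sum) be the corresponding nestohedron and $f_0(P_B)$ the number of its vertices. Call a function $f:[n]\to\{1,2,\dots\}$ $P_B$-generic if, as a vector in $(\mathbb{R}^n)^*$, it lies in the interior of the normal cone $\{c\mid c(w)\le c(v)\text{ for all }w\in P_B\}$ at some vertex $v$ of $P_B$, and let $F(P_B)=\sum_{f\ P_B\text{-generic}}x_{f(1)}\cdots x_{f(n)}$. For $m\in\mathbb{N}$ let $\mathrm{ps}_m$ be the specialization $x_i=1$ for $1\le i\le m$, $x_i=0$ for $i>m$. For a composition $\alpha=(a_1,\dots,a_k)$ of $n$ put $k(\alpha)=k$, and let $\zeta_\alpha(B)$ be the number of chains $\emptyset=I_0\subset I_1\subset\cdots\subset I_k=[n]$ such that, for all $1\le j\le k$, $|I_j\setminus I_{j-1}|=a_j$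 and $(B|_{I_j})/I_{j-1}$ is discrete (has only singletons as members). Here $B|_I=\{J\in B\mid J\subseteq I\}$, and $H/I$ consists of the nonempty sets $J$ disjoint from $I$ such that $I'\cup J\in H$ for some (possibly empty) $I'\subseteq I$. Then there is a unique polynomial $\chi(P_B,\cdot)\in\mathbb{Q}[X]$ with $\chi(P_B,m)=\mathrm{ps}_m(F(P_B))$ for all $m\in\mathbb{N}$, and \[\chi(P_B,-1)=\sum_{\alpha\models n}(-1)^{k(\alpha)}\zeta_\alpha(B)=(-1)^n f_0(P_B).\] -/

import Mathlib

open scoped Pointwise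
open Polynomial

namespace Nestohedra

/-- A building set on the finite set `V`: a collection of nonempty subsets of `V` that contains
all singletons and contains the union of any two of its members that meet. It need not be
connected, i.e. `V` itself need not be a member. -/
structure BuildingSet (V : Type*) [DecidableEq V] where
  /-- the members of the building set -/
  sets : Finset (Finset V)
  nonempty_of_mem : ∀ I ∈ sets, I.Nonempty
  singleton_mem : ∀ i : V, {i} ∈ sets
  union_mem : ∀ I ∈ sets, ∀ J ∈ sets, (I ∩ J).Nonempty → I ∪ J ∈ sets

/-- The induced subhypergraph `B|_I = {J ⊆ I : J ∈ B}`, a hypergraph on `I`. -/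
def restriction {V : Type*} (B : Set (Finset V)) (I : Finset V) : Set (Finset V) :=
  {J | J ⊆ I ∧ J ∈ B}

/-- The contraction `B / I`, a hypergraph on the complement of `I`: its members are the nonempty
sets `J` disjoint from `I` such that `I' ∪ J ∈ B` for some (possibly empty) `I' ⊆ I`. -/
def contraction {V : Type*} [DecidableEq V] (B : Set (Finset V)) (I : Finset V) :
    Set (Finset V) :=
  {J | J.Nonempty ∧ Disjoint J I ∧ ∃ I' ⊆ I, I' ∪ J ∈ B}

/-- A hypergraph is discrete if its only members are singletons. -/
def IsDiscrete {V : Type*} (B : Set (Finset V)) : Prop :=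
  ∀ J ∈ B, J.card = 1

/-- The chain `∅ = I_0 ⊂ I_1 ⊂ ⋯ ⊂ I_k = V` is a splitting chain of `B` of type
`α = (a_1, …, a_k)`: `|I_j \ I_{j-1}| = a_j` and `(B|_{I_j}) / I_{j-1}` is discrete, for all
`1 ≤ j ≤ k`. -/
structure IsSplittingChain {V : Type*} [DecidableEq V] [Fintype V] (B : BuildingSet V) {n : ℕ}
    (α : Composition n) (I : Fin (α.length + 1) → Finset V) : Prop where
  first : I 0 = ∅
  last : I (Fin.last α.length) = Finset.univ
  subset : ∀ j : Fin α.length, I j.castSucc ⊆ I j.succ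
  card : ∀ j : Fin α.length, (I j.succ \ I j.castSucc).card = α.blocksFun j
  discrete : ∀ j : Fin α.length,
    IsDiscrete (contraction (restriction (B.sets : Set (Finset V)) (I j.succ)) (I j.castSucc))

/-- `ζ_α(B)`, the number of splitting chains of `B` of type `α`. -/
noncomputable def zeta {V : Type*} [DecidableEq V] [Fintype V] (B : BuildingSet V) {n : ℕ}
    (α : Composition n) : ℕ :=
  {I : Fin (α.length + 1) → Finset V | IsSplittingChain B α I}.ncard

/-- The face `Δ_I = Conv {e_i : i ∈ I}` of the standard coordinate simplex. -/
def simplexFace {V : Type*} [DecidableEq V] (I : Finset V) : Set (V → ℝ) :=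
  convexHull ℝ ((fun i : V => (Pi.single i 1 : V → ℝ)) '' (I : Set V))

/-- The nestohedron `P_B`, the Minkowski sum of the simplices `Δ_I` over all `I ∈ B`. -/
noncomputable def nestohedron {V : Type*} [DecidableEq V] (B : BuildingSet V) : Set (V → ℝ) :=
  ∑ I ∈ B.sets, simplexFace I

/-- The (closed) normal cone of `Q` at `v`: all linear functionals, given by their coefficient
vectors, whose maximum over `Q` is attained at `v`. -/
def normalCone {V : Type*} [Fintype V] (Q : Set (V → ℝ)) (v : V → ℝ) : Set (V → ℝ) :=
  {c | ∀ w ∈ Q, c ⬝ᵥ w ≤ c ⬝ᵥ v}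

/-- The vertices of a polytope. -/
def vertices {V : Type*} (Q : Set (V → ℝ)) : Set (V → ℝ) :=
  Q.extremePoints ℝ

/-- A function with positive integer values is `Q`-generic if it lies in the interior of the
normal cone of `Q` at some vertex of `Q`. -/
def IsGeneric {V : Type*} [Fintype V] (Q : Set (V → ℝ)) (f : V → ℕ+) : Prop :=
  ∃ v ∈ vertices Q, (fun i => ((f i : ℕ) : ℝ)) ∈ interior (normalCone Q v)

/-- The exponent vector of the monomial `x_f = ∏ i, x_{f(i)}`. -/
noncomputable def exponent {V : Type*} [Fintype V] (f : V → ℕ+) : ℕ+ →₀ ℕ :=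
  ∑ i, Finsupp.single (f i) 1

/-- The formal power series `F(Q) = ∑ x_f`, the sum over all `Q`-generic functions `f`, in the
variables `x_1, x_2, …`: the coefficient of a monomial is the number of `Q`-generic `f` for which
`x_f` is that monomial. -/
noncomputable def genericEnumerator {V : Type*} [Fintype V] (Q : Set (V → ℝ)) :
    MvPowerSeries ℕ+ ℚ :=
  fun d => ({f : V → ℕ+ | IsGeneric Q f ∧ exponent f = d}.ncard : ℚ)

/-- The principal specialization `ps_m`: put `x_i = 1` for `1 ≤ i ≤ m` and `x_i = 0` for `i > m`.
It makes sense for power series of bounded degree, such as quasisymmetric functions, for which the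
sum of coefficients below is finite. -/
noncomputable def principalSpecialization (m : ℕ) (F : MvPowerSeries ℕ+ ℚ) : ℚ :=
  ∑ᶠ d ∈ {d : ℕ+ →₀ ℕ | ∀ i ∈ d.support, (i : ℕ) ≤ m}, MvPowerSeries.coeff d F

/-- `χ` is the polynomial `m ↦ χ(Q, m)`, i.e. `χ(m) = ps_m(F(Q))` for all natural numbers `m`. -/
def IsChiPolynomial {V : Type*} [Fintype V] (Q : Set (V → ℝ)) (χ : ℚ[X]) : Prop :=
  ∀ m : ℕ, χ.eval (m : ℚ) = principalSpecialization m (genericEnumerator Q)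

end Nestohedra

namespace Nestohedra

/-! Maximizing a functional over a Minkowski sum means maximizing it over each summand. So f is
generic exactly when it has a unique maximizer on every member of B, a condition that depends only
on the order of the values of f. If c_k (`packedCount`) is the number of generic functions with
image {1, …, k}, choosing the image inside {1, …, m} gives χ(m) = ∑ c_k binom(m, k). This is
polynomial in m, and binom(-1, k) = (-1)^k turns it into χ(-1) = ∑ (-1)^k c_k.

The sublevel sets of such a function form a splitting chain, and every splitting chain arises once
(`generic_iff_isDiscrete`, `zeta_eq_ncard`). Sorting by level sizes, c_k is the sum of ζ_α(B) over
the α with k parts, which gives the first formula.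

For the second, the open normal cones at the vertices partition the generic functions. Each cone is
cut out by inequalities d i < d j along an acyclic relation (`exists_relation_of_mem_vertices`), so
one vertex contributes a strict order polynomial at -1. By `sum_strictPacked` this is (-1)^n: strip
off the lowest level, an arbitrary nonempty set A of minimal elements, and use that the signs
(-1)^|A| sum to -1. -/

/-- A finite set each of whose elements is related to exactly one index in `t` is counted by
summing over `t`. -/
theorem ncard_eq_sum_of_existsUnique {α β : Type*} {s : Set α} (hs : s.Finite) (t : Finset β)
    (p : β → α → Prop) (h : ∀ a ∈ s, ∃! b, b ∈ t ∧ p b a) :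
    s.ncard = ∑ b ∈ t, {a | a ∈ s ∧ p b a}.ncard := by
  classical
  -- `choose!` needs a default index, which exists as soon as `s` has a point.
  rcases s.eq_empty_or_nonempty with rfl | ⟨a₀, ha₀⟩
  · simp
  have : Nonempty β := ⟨(h a₀ ha₀).choose⟩
  choose! f hf huniq using h
  have key : ∀ b ∈ t, {a | a ∈ s ∧ p b a}.ncard = (hs.toFinset.filter (fun a => f a = b)).card := by
    intro b hb
    rw [← Set.ncard_coe_finset]
    congr 1
    ext a
    simp only [Set.mem_ofPred_eq, Finset.coe_filter, Set.Finite.mem_toFinset]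
    constructor
    · rintro ⟨ha, hp⟩
      exact ⟨ha, (huniq a ha b ⟨hb, hp⟩).symm⟩
    · rintro ⟨ha, rfl⟩
      exact ⟨ha, (hf a ha).2⟩
  rw [Finset.sum_congr rfl key, Set.ncard_eq_toFinset_card s hs]
  exact Finset.card_eq_sum_card_fiberwise (fun a ha => (hf a (by simpa using ha)).1)

/-! ### Strict order polynomials at -1 -/

section Packed

variable {V : Type*}

/-- The functions that vanish exactly off `W`, take exactly the values `1, …, k` on `W`, and
increase strictly along `R` on `W`. -/
def strictPacked (R : V → V → Prop) (W : Finset V) (k : ℕ) : Set (V → ℕ) :=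
  {g | (∀ i, g i = 0 ↔ i ∉ W) ∧ W.image g = Finset.Icc 1 k ∧
    ∀ i ∈ W, ∀ j ∈ W, R i j → g i < g j}

theorem strictPacked_finite [Finite V] (R : V → V → Prop) (W : Finset V) (k : ℕ) :
    (strictPacked R W k).Finite := by
  refine (Set.Finite.pi' fun _ : V => Set.finite_Iic k).subset ?_
  rintro g ⟨h0, h1, -⟩ i
  by_cases hi : i ∈ W
  · have := Finset.mem_image_of_mem g hi
    rw [h1, Finset.mem_Icc] at this
    exact this.2
  · simp [(h0 i).2 hi]

theorem strictPacked_empty_zero (R : V → V → Prop) : (strictPacked R ∅ 0).ncard = 1 := by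
  rw [Set.ncard_eq_one]
  refine ⟨fun _ => 0, ?_⟩
  ext g
  simp [strictPacked, funext_iff]

theorem strictPacked_eq_empty {R : V → V → Prop} {W : Finset V} {k : ℕ} (h : W.card < k) :
    strictPacked R W k = ∅ := by
  rw [Set.eq_empty_iff_forall_notMem]
  rintro g ⟨-, h1, -⟩
  have := Finset.card_image_le (s := W) (f := g)
  rw [h1, Nat.card_Icc] at this
  omega

theorem strictPacked_zero {R : V → V → Prop} {W : Finset V} (h : W.Nonempty) :
    strictPacked R W 0 = ∅ := by
  rw [Set.eq_empty_iff_forall_notMem]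
  rintro g ⟨-, h1, -⟩
  simp at h1
  exact h.ne_empty h1

open Classical in
/-- The elements of `W` that are minimal for `R`. -/
noncomputable def minimals (R : V → V → Prop) (W : Finset V) : Finset V :=
  W.filter (fun j => ∀ i ∈ W, ¬ R i j)

theorem mem_minimals {R : V → V → Prop} {W : Finset V} {j : V} :
    j ∈ minimals R W ↔ j ∈ W ∧ ∀ i ∈ W, ¬ R i j := by
  classical
  simp [minimals]

theorem minimals_subset (R : V → V → Prop) (W : Finset V) : minimals R W ⊆ W :=
  fun _ h => (mem_minimals.1 h).1

/-- Removing the lowest level of a packed strict function. -/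
theorem strictPacked_fiber_ncard [DecidableEq V] {R : V → V → Prop} {W A : Finset V} (k : ℕ)
    (hA : A ⊆ minimals R W) (hne : A.Nonempty) :
    {g | g ∈ strictPacked R W (k + 1) ∧ W.filter (fun i => g i = 1) = A}.ncard =
      (strictPacked R (W \ A) k).ncard := by
  have hAW : A ⊆ W := hA.trans (minimals_subset R W)
  have hAmin : ∀ j ∈ A, ∀ i ∈ W, ¬ R i j := fun j hj => (mem_minimals.1 (hA hj)).2
  -- Truncated subtraction keeps the value 0 off `W` and sends level 1, which is `A`, to 0 as well;
  -- hence the new support is `W \ A`.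
  refine Set.ncard_congr (fun g _ i => g i - 1) ?_ ?_ ?_
  · rintro g ⟨⟨h0, h1, h2⟩, hfib⟩
    have hmem : ∀ i, i ∈ A ↔ i ∈ W ∧ g i = 1 := fun i => by rw [← hfib, Finset.mem_filter]
    refine ⟨fun i => ?_, ?_, ?_⟩
    · have h3 := h0 i
      have h4 := hmem i
      rw [Finset.mem_sdiff, show g i - 1 = 0 ↔ g i = 0 ∨ g i = 1 by omega]
      tauto
    · ext x
      simp only [Finset.mem_image, Finset.mem_sdiff, Finset.mem_Icc]
      constructor
      · rintro ⟨i, ⟨hi, hi'⟩, rfl⟩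
        have h3 := Finset.mem_image_of_mem g hi
        rw [h1, Finset.mem_Icc] at h3
        have : g i ≠ 1 := fun h => hi' ((hmem i).2 ⟨hi, h⟩)
        omega
      · rintro ⟨hx1, hx2⟩
        have h3 : x + 1 ∈ W.image g := by rw [h1, Finset.mem_Icc]; omega
        obtain ⟨i, hi, hgi⟩ := Finset.mem_image.1 h3
        refine ⟨i, ⟨hi, fun h => ?_⟩, by omega⟩
        have := ((hmem i).1 h).2
        omega
    · intro i hi j hj hij
      rw [Finset.mem_sdiff] at hi hj
      have := h2 i hi.1 j hj.1 hij
      have : g i ≠ 0 := fun h => (h0 i).1 h hi.1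
      change g i - 1 < g j - 1
      omega
  · rintro g g' ⟨⟨h0, -, -⟩, -⟩ ⟨⟨h0', -, -⟩, -⟩ h
    ext i
    have h3 := h0 i
    have h4 := h0' i
    have h5 : g i - 1 = g' i - 1 := congrFun h i
    by_cases hi : i ∈ W
    · have : g i ≠ 0 := fun h => h3.1 h hi
      have : g' i ≠ 0 := fun h => h4.1 h hi
      omega
    · rw [h3.2 hi, h4.2 hi]
  · rintro g ⟨h0, h1, h2⟩
    have hz : ∀ i ∈ W, (g i = 0 ↔ i ∈ A) := fun i hi => by
      rw [h0 i, Finset.mem_sdiff]; tauto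
    -- The inverse raises only the points of `W`, so that `A`, where `g` vanishes, becomes level 1.
    refine ⟨fun i => if i ∈ W then g i + 1 else 0, ⟨⟨fun i => by simp, ?_, ?_⟩, ?_⟩, ?_⟩
    · ext x
      simp only [Finset.mem_image, Finset.mem_Icc]
      constructor
      · rintro ⟨i, hi, rfl⟩
        rw [if_pos hi]
        by_cases hi' : i ∈ A
        · rw [(hz i hi).2 hi']; omega
        · have h3 := Finset.mem_image_of_mem g (Finset.mem_sdiff.2 ⟨hi, hi'⟩)
          rw [h1, Finset.mem_Icc] at h3
          omega
      · rintro ⟨hx1, hx2⟩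
        rcases Nat.eq_or_lt_of_le hx1 with rfl | hx
        · obtain ⟨i, hi⟩ := hne
          exact ⟨i, hAW hi, by rw [if_pos (hAW hi), (hz i (hAW hi)).2 hi]⟩
        · have h3 : x - 1 ∈ (W \ A).image g := by rw [h1, Finset.mem_Icc]; omega
          obtain ⟨i, hi, hgi⟩ := Finset.mem_image.1 h3
          have hi := (Finset.mem_sdiff.1 hi).1
          exact ⟨i, hi, by rw [if_pos hi]; omega⟩
    · intro i hi j hj hij
      simp only [hi, hj, if_true]
      have hjA : j ∉ A := fun h => hAmin j h i hi hij
      by_cases hiA : i ∈ A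
      · have h3 := (hz i hi).2 hiA
        have h4 : g j ≠ 0 := fun h => hjA ((hz j hj).1 h)
        omega
      · have := h2 i (Finset.mem_sdiff.2 ⟨hi, hiA⟩) j (Finset.mem_sdiff.2 ⟨hj, hjA⟩) hij
        omega
    · ext i
      simp only [Finset.mem_filter]
      constructor
      · rintro ⟨hi, h⟩
        rw [if_pos hi] at h
        exact (hz i hi).1 (by omega)
      · intro hi
        exact ⟨hAW hi, by rw [if_pos (hAW hi), (hz i (hAW hi)).2 hi]⟩
    · ext i
      by_cases hi : i ∈ W
      · simp [hi]
      · simp [hi, (h0 i).2 (fun h => hi (Finset.mem_sdiff.1 h).1)]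

/-- The lowest level is nonempty because the value 1 is attained, and it consists of minimal
elements because nothing in `W` lies below value 1. -/
theorem strictPacked_succ_ncard [Finite V] [DecidableEq V] (R : V → V → Prop) (W : Finset V) (k : ℕ) :
    (strictPacked R W (k + 1)).ncard =
      ∑ A ∈ (minimals R W).powerset.erase ∅, (strictPacked R (W \ A) k).ncard := by
  rw [ncard_eq_sum_of_existsUnique (strictPacked_finite R W (k + 1))
    ((minimals R W).powerset.erase ∅) (fun A g => W.filter (fun i => g i = 1) = A)]
  · refine Finset.sum_congr rfl fun A hA => ?_
    rw [Finset.mem_erase, Finset.mem_powerset] at hA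
    exact strictPacked_fiber_ncard k hA.2 (Finset.nonempty_iff_ne_empty.2 hA.1)
  · rintro g ⟨h0, h1, h2⟩
    refine ⟨W.filter (fun i => g i = 1), ⟨?_, rfl⟩, fun A hA => hA.2.symm⟩
    rw [Finset.mem_erase, Finset.mem_powerset]
    constructor
    · have h3 : 1 ∈ W.image g := by rw [h1, Finset.mem_Icc]; omega
      obtain ⟨i, hi, hgi⟩ := Finset.mem_image.1 h3
      exact Finset.ne_empty_of_mem (Finset.mem_filter.2 ⟨hi, hgi⟩)
    · intro j hj
      rw [Finset.mem_filter] at hj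
      refine mem_minimals.2 ⟨hj.1, fun i hi hij => ?_⟩
      have := h2 i hi j hj.1 hij
      exact (h0 i).1 (by omega) hi

/-- Reciprocity for the strict order polynomial at `-1`: the alternating count of packed strict
functions of an acyclic relation. -/
theorem sum_strictPacked [Finite V] [DecidableEq V] {R : V → V → Prop} (c : V → ℝ) (hc : ∀ i j, R i j → c i < c j)
    (W : Finset V) (N : ℕ) (hN : W.card < N) :
    ∑ k ∈ Finset.range N, (-1 : ℚ) ^ k * ((strictPacked R W k).ncard : ℚ) = (-1) ^ W.card := by
  induction W using Finset.strongInduction generalizing N with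
  | H W ih =>
    rcases W.eq_empty_or_nonempty with rfl | hW
    · rw [Finset.sum_eq_single_of_mem 0 (Finset.mem_range.2 (by simpa using hN))]
      · simp [strictPacked_empty_zero]
      · intro k _ hk
        rw [strictPacked_eq_empty (by simpa using Nat.pos_of_ne_zero hk)]
        simp
    · obtain ⟨N, rfl⟩ : ∃ M, N = M + 1 := ⟨N - 1, by omega⟩
      rw [Finset.sum_range_succ', strictPacked_zero hW]
      -- Since `c` increases along `R`, a point of `W` with least `c` is minimal.
      have hmin : (minimals R W).Nonempty := by
        obtain ⟨i, hi, him⟩ := W.exists_min_image c hW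
        exact ⟨i, mem_minimals.2 ⟨hi, fun j hj hji =>
          absurd (hc j i hji) (not_lt.2 (him j hj))⟩⟩
      have hsub : minimals R W ⊆ W := minimals_subset R W
      -- Induction applies to `W \ A`, and (-1)^(|W| - |A|) = (-1)^|W| (-1)^|A|.
      have key : ∀ A ∈ (minimals R W).powerset.erase ∅,
          ∑ k ∈ Finset.range N, (-1 : ℚ) ^ k * ((strictPacked R (W \ A) k).ncard : ℚ) =
            (-1) ^ W.card * (-1) ^ A.card := by
        intro A hA
        rw [Finset.mem_erase, Finset.mem_powerset] at hA
        have hAW := hA.2.trans hsub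
        have hAc : 0 < A.card := Finset.card_pos.2 (Finset.nonempty_iff_ne_empty.2 hA.1)
        have hle := Finset.card_le_card hAW
        have hcard := Finset.card_sdiff_of_subset hAW
        rw [ih (W \ A) (Finset.sdiff_ssubset hAW (Finset.card_pos.1 hAc)) N (by omega), hcard]
        obtain ⟨d, hd⟩ := Nat.exists_eq_add_of_le hle
        rw [hd, Nat.add_sub_cancel_left, pow_add, mul_right_comm, ← mul_pow]
        simp
      have hsum : ∑ A ∈ (minimals R W).powerset.erase ∅, (-1 : ℚ) ^ A.card = -1 := by
        have h := Finset.sum_powerset_neg_one_pow_card_of_nonempty hmin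
        have h' : ∑ A ∈ (minimals R W).powerset, (-1 : ℚ) ^ A.card = 0 := by exact_mod_cast h
        rw [← Finset.add_sum_erase _ _ (Finset.empty_mem_powerset _)] at h'
        simp only [Finset.card_empty, pow_zero] at h'
        linarith
      calc _ = ∑ k ∈ Finset.range N, ∑ A ∈ (minimals R W).powerset.erase ∅,
              -((-1 : ℚ) ^ k * ((strictPacked R (W \ A) k).ncard : ℚ)) := by
            rw [Set.ncard_empty, Nat.cast_zero, mul_zero, add_zero]
            refine Finset.sum_congr rfl fun k _ => ?_
            rw [strictPacked_succ_ncard, Nat.cast_sum, Finset.mul_sum]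
            exact Finset.sum_congr rfl fun A _ => by ring
        _ = -∑ A ∈ (minimals R W).powerset.erase ∅, (-1) ^ W.card * (-1) ^ A.card := by
            rw [Finset.sum_comm, ← Finset.sum_neg_distrib]
            refine Finset.sum_congr rfl fun A hA => ?_
            rw [Finset.sum_neg_distrib, key A hA]
        _ = (-1) ^ W.card := by rw [← Finset.mul_sum, hsum]; ring

end Packed

/-! ### Interiors of normal cones and vertices -/

section NormalCone

variable {V : Type*} [Fintype V]

/-- A functional in the interior of a normal cone attains its maximum only there. -/
theorem dotProduct_lt_of_mem_interior_normalCone {Q : Set (V → ℝ)} {v w c : V → ℝ}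
    (hc : c ∈ interior (normalCone Q v)) (hw : w ∈ Q) (hne : w ≠ v) : c ⬝ᵥ w < c ⬝ᵥ v := by
  -- Push `c` slightly towards `w - v`. Staying in the cone forces c·(w - v) + (δ/2)|w - v|² ≤ 0.
  have hcont : Continuous fun ε : ℝ => c + ε • (w - v) := by fun_prop
  have h0 : (fun ε : ℝ => c + ε • (w - v)) ⁻¹' interior (normalCone Q v) ∈ nhds (0 : ℝ) :=
    (isOpen_interior.preimage hcont).mem_nhds (by simpa using hc)
  obtain ⟨δ, hδ, hball⟩ := Metric.mem_nhds_iff.1 h0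
  have hmem : c + (δ / 2) • (w - v) ∈ normalCone Q v :=
    interior_subset (hball (by simp [abs_of_pos hδ]; linarith))
  have h1 := hmem w hw
  have h2 : 0 < (w - v) ⬝ᵥ (w - v) := by
    have h3 := (dotProduct_self_eq_zero (v := w - v)).not.2 (sub_ne_zero.2 hne)
    exact lt_of_le_of_ne (Finset.sum_nonneg fun i _ => mul_self_nonneg _) (Ne.symm h3)
  rw [add_dotProduct, add_dotProduct, smul_dotProduct, smul_dotProduct] at h1
  rw [dotProduct_sub] at h2
  simp only [smul_eq_mul] at h1
  nlinarith

/-- A functional with unique maximum among finitely many points lies in the interior of the normal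
cone of their convex hull. -/
theorem mem_interior_normalCone_of_forall_lt {T : Set (V → ℝ)} (hT : T.Finite) {v c : V → ℝ}
    (h : ∀ t ∈ T, t ≠ v → c ⬝ᵥ t < c ⬝ᵥ v) :
    c ∈ interior (normalCone (convexHull ℝ T) v) := by
  have hopen : IsOpen (⋂ t ∈ T \ {v}, {d : V → ℝ | d ⬝ᵥ t < d ⬝ᵥ v}) := by
    refine (hT.subset Set.sdiff_subset).isOpen_biInter fun t _ => ?_
    exact isOpen_lt (by unfold dotProduct; fun_prop) (by unfold dotProduct; fun_prop)
  refine mem_interior.2 ⟨_, ?_, hopen, ?_⟩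
  · intro d hd w hw
    have hconv : Convex ℝ {w : V → ℝ | d ⬝ᵥ w ≤ d ⬝ᵥ v} :=
      convex_halfSpace_le ⟨fun x y => dotProduct_add d x y, fun r x => dotProduct_smul r d x⟩ _
    refine convexHull_min (fun t ht => ?_) hconv hw
    by_cases htv : t = v
    · simp [htv]
    · have h1 : d ⬝ᵥ t < d ⬝ᵥ v := Set.mem_iInter₂.1 hd t ⟨ht, htv⟩
      exact h1.le
  · exact Set.mem_iInter₂.2 fun t ht => h t ht.1 ht.2

/-- The vertices of the convex hull of finitely many points are exposed. -/
theorem exists_mem_interior_normalCone {T : Set (V → ℝ)} (hT : T.Finite) {v : V → ℝ}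
    (hv : v ∈ vertices (convexHull ℝ T)) :
    ∃ c, c ∈ interior (normalCone (convexHull ℝ T) v) := by
  classical
  rw [vertices, (convex_convexHull ℝ T).mem_extremePoints_iff_mem_sdiff_convexHull_sdiff] at hv
  -- An extreme point is not in the hull of the other generators, so Hahn–Banach separates it
  -- strictly from them.
  have hnot : v ∉ convexHull ℝ (T \ {v}) := fun h =>
    hv.2 (convexHull_mono (Set.sdiff_subset_sdiff_left (subset_convexHull ℝ T)) h)
  obtain ⟨f, u, hlt, hgt⟩ := geometric_hahn_banach_closed_point (convex_convexHull ℝ (T \ {v}))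
    ((hT.subset Set.sdiff_subset).isClosed_convexHull ℝ) hnot
  have hf : ∀ x : V → ℝ, (fun i => f (fun j => if i = j then 1 else 0)) ⬝ᵥ x = f x := by
    intro x
    have := LinearMap.pi_apply_eq_sum_univ (f : (V → ℝ) →ₗ[ℝ] ℝ) x
    simp only [ContinuousLinearMap.coe_coe, smul_eq_mul] at this
    rw [this, dotProduct]
    exact Finset.sum_congr rfl fun i _ => mul_comm _ _
  refine ⟨fun i => f (fun j => if i = j then 1 else 0),
    mem_interior_normalCone_of_forall_lt hT fun t ht htv => ?_⟩
  rw [hf, hf]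
  exact (hlt t (subset_convexHull ℝ _ ⟨ht, htv⟩)).trans hgt

/-- A unique maximizer cannot be averaged from other points: one of them would have a strictly
smaller value. -/
theorem mem_vertices_of_mem_interior_normalCone {Q : Set (V → ℝ)} {v c : V → ℝ} (hv : v ∈ Q)
    (hc : c ∈ interior (normalCone Q v)) : v ∈ vertices Q := by
  refine mem_extremePoints.2 ⟨hv, fun x hx y hy hxy => ?_⟩
  obtain ⟨a, b, ha, hb, hab, hv'⟩ := hxy
  have hle : ∀ w ∈ Q, c ⬝ᵥ w ≤ c ⬝ᵥ v := fun w hw => interior_subset hc w hw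
  have heq : a * (c ⬝ᵥ x) + b * (c ⬝ᵥ y) = c ⬝ᵥ v := by
    rw [← hv', dotProduct_add, dotProduct_smul, dotProduct_smul, smul_eq_mul, smul_eq_mul]
  have hb' : b = 1 - a := by linarith
  subst hb'
  have hx' := hle x hx
  have hy' := hle y hy
  constructor
  · by_contra hne
    have := dotProduct_lt_of_mem_interior_normalCone hc hx hne
    nlinarith
  · by_contra hne
    have := dotProduct_lt_of_mem_interior_normalCone hc hy hne
    nlinarith

end NormalCone

/-! ### Vertices of the nestohedron and unique maximizers -/

section Argmax

variable {V : Type*}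

/-- `j` is the unique maximizer of `c` on `I`. -/
def IsArgmax {α : Type*} [LT α] (c : V → α) (I : Finset V) (j : V) : Prop :=
  j ∈ I ∧ ∀ i ∈ I, i ≠ j → c i < c j

theorem IsArgmax.unique {α : Type*} [Preorder α] {c : V → α} {I : Finset V} {j j' : V}
    (h : IsArgmax c I j) (h' : IsArgmax c I j') : j = j' := by
  by_contra hne
  exact lt_asymm (h.2 j' h'.1 (Ne.symm hne)) (h'.2 j h.1 hne)

variable [DecidableEq V]

/-- The sum of the basis vectors selected by `ψ` from the members of `B`. -/
noncomputable def selectionVector (B : BuildingSet V) (ψ : B.sets → V) : V → ℝ :=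
  ∑ I, Pi.single (ψ I) 1

/-- The sums of one basis vector from each member of `B`. -/
def selectionVectors (B : BuildingSet V) : Set (V → ℝ) :=
  {t | ∃ ψ : B.sets → V, (∀ I, ψ I ∈ I.1) ∧ selectionVector B ψ = t}

/-- Taking convex hulls commutes with Minkowski sums. -/
theorem nestohedron_eq_convexHull (B : BuildingSet V) :
    nestohedron B = convexHull ℝ (selectionVectors B) := by
  have h : selectionVectors B =
      ∑ I : B.sets, (fun i : V => (Pi.single i 1 : V → ℝ)) '' (I.1 : Set V) := by
    ext t
    rw [Set.mem_fintype_sum]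
    constructor
    · rintro ⟨ψ, hψ, rfl⟩
      exact ⟨fun I => Pi.single (ψ I) 1, fun I => ⟨_, hψ I, rfl⟩, rfl⟩
    · rintro ⟨g, hg, rfl⟩
      choose ψ hψ using hg
      exact ⟨ψ, fun I => (hψ I).1, Finset.sum_congr rfl fun I _ => (hψ I).2⟩
  rw [h, convexHull_sum, nestohedron, ← Finset.sum_coe_sort]
  rfl

theorem selectionVectors_finite [Finite V] (B : BuildingSet V) : (selectionVectors B).Finite :=
  (Set.finite_range (selectionVector B)).subset fun _ ⟨ψ, _, h⟩ => ⟨ψ, h⟩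

theorem vertices_finite [Finite V] (B : BuildingSet V) : (vertices (nestohedron B)).Finite := by
  rw [nestohedron_eq_convexHull]
  exact (selectionVectors_finite B).subset extremePoints_convexHull_subset

variable [Fintype V]

theorem dotProduct_selectionVector (B : BuildingSet V) (c : V → ℝ) (ψ : B.sets → V) :
    c ⬝ᵥ selectionVector B ψ = ∑ I, c (ψ I) := by
  simp [selectionVector, dotProduct_sum]

/-- The value of `c` splits as a sum over the members of `B`, so a single non-maximal choice makes
the total strictly smaller. -/
theorem eq_of_le_dotProduct {B : BuildingSet V} {c : V → ℝ} {ψ ψ' : B.sets → V}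
    (hψ : ∀ I, IsArgmax c I.1 (ψ I)) (hψ' : ∀ I, ψ' I ∈ I.1)
    (hle : c ⬝ᵥ selectionVector B ψ ≤ c ⬝ᵥ selectionVector B ψ') : ψ' = ψ := by
  ext I
  by_contra hne
  rw [dotProduct_selectionVector, dotProduct_selectionVector] at hle
  refine absurd hle (not_le.2 (Finset.sum_lt_sum (fun J _ => ?_)
    ⟨I, Finset.mem_univ I, (hψ I).2 _ (hψ' I) hne⟩))
  by_cases h : ψ' J = ψ J
  · rw [h]
  · exact ((hψ J).2 _ (hψ' J) h).le

/-- The generic functionals are those with a unique maximizer on each member of `B`; the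
corresponding vertex is the sum of the basis vectors at these maximizers. -/
theorem mem_vertices_and_mem_interior_iff {B : BuildingSet V} {c v : V → ℝ} :
    (v ∈ vertices (nestohedron B) ∧ c ∈ interior (normalCone (nestohedron B) v)) ↔
      ∃ ψ : B.sets → V, (∀ I, IsArgmax c I.1 (ψ I)) ∧ selectionVector B ψ = v := by
  rw [nestohedron_eq_convexHull]
  constructor
  · rintro ⟨hv, hc⟩
    obtain ⟨ψ, hψ, rfl⟩ := extremePoints_convexHull_subset hv
    refine ⟨ψ, fun I => ⟨hψ I, fun i hi hne => ?_⟩, rfl⟩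
    -- Compare with the selection that takes the competitor `i` in place of `ψ I`.
    have hmem : selectionVector B (Function.update ψ I i) ∈ selectionVectors B := by
      refine ⟨_, fun J => ?_, rfl⟩
      by_cases h : J = I
      · subst h; simpa using hi
      · rw [Function.update_of_ne h]; exact hψ J
    -- Used twice: for the coordinate functional at `i`, to see that the two vectors differ, and for
    -- `c`.
    have hsum : ∀ d : V → ℝ, d ⬝ᵥ selectionVector B (Function.update ψ I i) - d i =
        d ⬝ᵥ selectionVector B ψ - d (ψ I) := by
      intro d
      rw [dotProduct_selectionVector, dotProduct_selectionVector,
        ← Finset.add_sum_erase _ _ (Finset.mem_univ I),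
        ← Finset.add_sum_erase _ (fun J => d (ψ J)) (Finset.mem_univ I), Function.update_self,
        add_sub_cancel_left, add_sub_cancel_left]
      refine Finset.sum_congr rfl fun J hJ => ?_
      rw [Function.update_of_ne (Finset.ne_of_mem_erase hJ)]
    have hne' : selectionVector B (Function.update ψ I i) ≠ selectionVector B ψ := by
      intro h
      have := hsum (Pi.single i 1)
      rw [h, Pi.single_eq_same, Pi.single_eq_of_ne (Ne.symm hne)] at this
      linarith
    have h1 := dotProduct_lt_of_mem_interior_normalCone hc (subset_convexHull ℝ _ hmem) hne'
    linarith [hsum c]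
  · rintro ⟨ψ, hψ, rfl⟩
    have hmem : selectionVector B ψ ∈ selectionVectors B := ⟨ψ, fun I => (hψ I).1, rfl⟩
    have hc : c ∈ interior (normalCone (convexHull ℝ (selectionVectors B))
        (selectionVector B ψ)) := by
      refine mem_interior_normalCone_of_forall_lt (selectionVectors_finite B) fun t ht hne => ?_
      obtain ⟨ψ', hψ', rfl⟩ := ht
      by_contra hle
      exact hne (by rw [eq_of_le_dotProduct hψ hψ' (not_lt.1 hle)])
    exact ⟨mem_vertices_of_mem_interior_normalCone (subset_convexHull ℝ _ hmem) hc, hc⟩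

/-- The functionals with a maximum exactly at a given vertex are those that increase strictly along
an acyclic relation. -/
theorem exists_relation_of_mem_vertices {B : BuildingSet V} {v : V → ℝ}
    (hv : v ∈ vertices (nestohedron B)) :
    ∃ (R : V → V → Prop) (c : V → ℝ), (∀ i j, R i j → c i < c j) ∧ ∀ d : V → ℝ,
      d ∈ interior (normalCone (nestohedron B) v) ↔ ∀ i j, R i j → d i < d j := by
  obtain ⟨c, hc⟩ : ∃ c, c ∈ interior (normalCone (nestohedron B) v) := by
    rw [nestohedron_eq_convexHull] at hv ⊢
    exact exists_mem_interior_normalCone (selectionVectors_finite B) hv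
  obtain ⟨ψ, hψ, hψv⟩ := mem_vertices_and_mem_interior_iff.1 ⟨hv, hc⟩
  have hiff : ∀ d : V → ℝ, (∀ I, IsArgmax d I.1 (ψ I)) ↔
      ∀ i j, (∃ I : B.sets, i ∈ I.1 ∧ i ≠ j ∧ ψ I = j) → d i < d j := by
    intro d
    constructor
    · rintro hd i j ⟨I, hi, hne, rfl⟩
      exact (hd I).2 i hi hne
    · exact fun h I => ⟨(hψ I).1, fun i hi hne => h i _ ⟨I, hi, hne, rfl⟩⟩
  refine ⟨_, c, (hiff c).1 hψ, fun d => ?_⟩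
  rw [← hiff d]
  constructor
  · intro hd
    obtain ⟨ψ', hψ', hψv'⟩ := mem_vertices_and_mem_interior_iff.1 ⟨hv, hd⟩
    -- Different selections might have the same sum, but a selection of unique maximizers is
    -- determined by its sum.
    have : ψ = ψ' := eq_of_le_dotProduct hψ' (fun I => (hψ I).1) (by rw [hψv, hψv'])
    rwa [this]
  · exact fun hd => (mem_vertices_and_mem_interior_iff.2 ⟨ψ, hd, hψv⟩).2

end Argmax

/-! ### Generic functions as functions to the naturals -/

section Generic

variable {V : Type*}

/-- A function is generic for `B` if it has a unique maximizer on each member of `B`. -/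
def BuildingSet.Generic [DecidableEq V] (B : BuildingSet V) (g : V → ℕ) : Prop :=
  ∀ I : B.sets, ∃ j, IsArgmax g I.1 j

theorem isArgmax_natCast {g : V → ℕ} {I : Finset V} {j : V} :
    IsArgmax (fun i => (g i : ℝ)) I j ↔ IsArgmax g I j := by
  simp [IsArgmax]

theorem BuildingSet.Generic.comp [DecidableEq V] {B : BuildingSet V} {g : V → ℕ} (hg : B.Generic g) {e : ℕ → ℕ}
    {S : Set ℕ} (he : StrictMonoOn e S) (hS : ∀ i, g i ∈ S) : B.Generic (fun i => e (g i)) :=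
  fun I => (hg I).imp fun _ hj => ⟨hj.1, fun i hi hne => he (hS _) (hS _) (hj.2 i hi hne)⟩

variable [DecidableEq V] [Fintype V]

theorem generic_iff_exists_vertex {B : BuildingSet V} {g : V → ℕ} :
    B.Generic g ↔ ∃ v ∈ vertices (nestohedron B),
      (fun i => (g i : ℝ)) ∈ interior (normalCone (nestohedron B) v) := by
  constructor
  · intro hg
    choose ψ hψ using hg
    exact ⟨_, mem_vertices_and_mem_interior_iff.2
      ⟨ψ, fun I => isArgmax_natCast.2 (hψ I), rfl⟩⟩
  · rintro ⟨v, hv⟩ I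
    obtain ⟨ψ, hψ, -⟩ := mem_vertices_and_mem_interior_iff.1 hv
    exact ⟨ψ I, isArgmax_natCast.1 (hψ I)⟩

/-- The generic functions with image `S`. -/
def genericOnto (B : BuildingSet V) (S : Finset ℕ) : Set (V → ℕ) :=
  {g | B.Generic g ∧ Finset.univ.image g = S}

theorem genericOnto_finite (B : BuildingSet V) (S : Finset ℕ) : (genericOnto B S).Finite := by
  refine (Set.Finite.pi' fun _ : V => S.finite_toSet).subset ?_
  rintro g ⟨-, rfl⟩ i
  exact Finset.mem_coe.2 (Finset.mem_image_of_mem g (Finset.mem_univ i))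

theorem exists_strictMonoOn_image_eq {S S' : Finset ℕ} (h : S.card = S'.card) :
    ∃ e : ℕ → ℕ, StrictMonoOn e S ∧ S.image e = S' := by
  let φ : S ≃o S' := (S.orderIsoOfFin rfl).symm.trans (S'.orderIsoOfFin h.symm)
  refine ⟨fun x => if hx : x ∈ S then φ ⟨x, hx⟩ else 0, ?_, ?_⟩
  · intro x hx y hy hxy
    have hx : x ∈ S := hx
    have hy : y ∈ S := hy
    simp only [hx, hy, dif_pos]
    exact φ.strictMono hxy
  · ext y
    simp only [Finset.mem_image]
    constructor
    · rintro ⟨x, hx, rfl⟩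
      rw [dif_pos hx]
      exact (φ ⟨x, hx⟩).2
    · intro hy
      refine ⟨φ.symm ⟨y, hy⟩, (φ.symm ⟨y, hy⟩).2, ?_⟩
      simp

/-- Relabelling values by the order isomorphism from `S` to `S'` preserves unique maximizers. By
symmetry the inequality is an equality. -/
theorem genericOnto_ncard_le (B : BuildingSet V) {S S' : Finset ℕ} (h : S.card = S'.card) :
    (genericOnto B S).ncard ≤ (genericOnto B S').ncard := by
  obtain ⟨e, he, hS⟩ := exists_strictMonoOn_image_eq h
  have hmem : ∀ g ∈ genericOnto B S, ∀ i, g i ∈ (S : Set ℕ) := by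
    rintro g ⟨-, rfl⟩ i
    exact Finset.mem_coe.2 (Finset.mem_image_of_mem g (Finset.mem_univ i))
  refine Set.ncard_le_ncard_of_injOn (fun g i => e (g i)) ?_ ?_ (genericOnto_finite B S')
  · intro g hg
    refine ⟨hg.1.comp he (hmem g hg), ?_⟩
    rw [← hS, ← hg.2, Finset.image_image]
    rfl
  · intro g hg g' hg' heq
    ext i
    exact he.injOn (hmem g hg i) (hmem g' hg' i) (congrFun heq i)

/-- The number of generic functions with image `{1, …, k}`. -/
noncomputable def packedCount (B : BuildingSet V) (k : ℕ) : ℕ :=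
  (genericOnto B (Finset.Icc 1 k)).ncard

theorem genericOnto_ncard (B : BuildingSet V) (S : Finset ℕ) :
    (genericOnto B S).ncard = packedCount B S.card :=
  le_antisymm (genericOnto_ncard_le B (by simp)) (genericOnto_ncard_le B (by simp))

theorem packedCount_eq_zero (B : BuildingSet V) {k : ℕ} (hk : Fintype.card V < k) :
    packedCount B k = 0 := by
  rw [packedCount, Set.ncard_eq_zero (genericOnto_finite B _), Set.eq_empty_iff_forall_notMem]
  rintro g ⟨-, h⟩
  have := Finset.card_image_le (s := Finset.univ) (f := g)
  rw [h, Nat.card_Icc, Finset.card_univ] at this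
  omega

/-- Each generic function lies in the open cone of exactly one vertex, and the alternating count
within each cone is (-1)^|V|. -/
theorem sum_packedCount (B : BuildingSet V) :
    ∑ k ∈ Finset.range (Fintype.card V + 1), (-1 : ℚ) ^ k * (packedCount B k : ℚ) =
      (-1) ^ Fintype.card V * ((vertices (nestohedron B)).ncard : ℚ) := by
  have hfib : ∀ k, packedCount B k = ∑ v ∈ (vertices_finite B).toFinset,
      {g | g ∈ genericOnto B (Finset.Icc 1 k) ∧
        (fun i => (g i : ℝ)) ∈ interior (normalCone (nestohedron B) v)}.ncard := by
    intro k
    refine ncard_eq_sum_of_existsUnique (genericOnto_finite B _) _ _ fun g hg => ?_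
    obtain ⟨v, hv, hgv⟩ := generic_iff_exists_vertex.1 hg.1
    refine ⟨v, ⟨by simpa using hv, hgv⟩, ?_⟩
    rintro w ⟨hw, hgw⟩
    by_contra hne
    rw [Set.Finite.mem_toFinset] at hw
    exact lt_asymm (dotProduct_lt_of_mem_interior_normalCone hgv hw.1 hne)
      (dotProduct_lt_of_mem_interior_normalCone hgw hv.1 (Ne.symm hne))
  have hvert : ∀ v ∈ (vertices_finite B).toFinset,
      ∑ k ∈ Finset.range (Fintype.card V + 1), (-1 : ℚ) ^ k *
        (({g | g ∈ genericOnto B (Finset.Icc 1 k) ∧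
          (fun i => (g i : ℝ)) ∈ interior (normalCone (nestohedron B) v)}.ncard : ℕ) : ℚ) =
        (-1) ^ Fintype.card V := by
    intro v hv
    rw [Set.Finite.mem_toFinset] at hv
    obtain ⟨R, c, hc, hR⟩ := exists_relation_of_mem_vertices hv
    have hset : ∀ k, {g | g ∈ genericOnto B (Finset.Icc 1 k) ∧
        (fun i => (g i : ℝ)) ∈ interior (normalCone (nestohedron B) v)} =
        strictPacked R Finset.univ k := by
      intro k
      ext g
      constructor
      · rintro ⟨⟨-, himg⟩, hg⟩
        refine ⟨fun i => ?_, himg, fun i _ j _ hij => ?_⟩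
        · have := Finset.mem_image_of_mem g (Finset.mem_univ i)
          rw [himg, Finset.mem_Icc] at this
          simp only [Finset.mem_univ, not_true_eq_false, iff_false]
          omega
        · exact_mod_cast (hR _).1 hg i j hij
      · rintro ⟨-, himg, hg⟩
        have hmem : (fun i => (g i : ℝ)) ∈ interior (normalCone (nestohedron B) v) :=
          (hR _).2 fun i j hij =>
            Nat.cast_lt.2 (hg i (Finset.mem_univ i) j (Finset.mem_univ j) hij)
        exact ⟨⟨generic_iff_exists_vertex.2 ⟨v, hv, hmem⟩, himg⟩, hmem⟩
    simp only [hset]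
    exact sum_strictPacked c hc Finset.univ _ (by simp)
  calc _ = ∑ v ∈ (vertices_finite B).toFinset, (-1 : ℚ) ^ Fintype.card V := by
        rw [← Finset.sum_congr rfl hvert, Finset.sum_comm]
        refine Finset.sum_congr rfl fun k _ => ?_
        rw [hfib, Nat.cast_sum, Finset.mul_sum]
    _ = _ := by
        rw [Finset.sum_const, nsmul_eq_mul, mul_comm,
          Set.ncard_eq_toFinset_card _ (vertices_finite B)]

end Generic

/-! ### Splitting chains as sublevel sets -/

section SplittingChain

variable {V : Type*} [DecidableEq V] [Fintype V]

/-- The set of elements of value at most `j`. -/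
def sublevel (g : V → ℕ) (j : ℕ) : Finset V := Finset.univ.filter fun i => g i ≤ j

/-- The set of elements of value `j`. -/
def level (g : V → ℕ) (j : ℕ) : Finset V := Finset.univ.filter fun i => g i = j

theorem sublevel_sdiff (g : V → ℕ) (j : ℕ) :
    sublevel g (j + 1) \ sublevel g j = level g (j + 1) := by
  ext i
  simp only [sublevel, level, Finset.mem_sdiff, Finset.mem_filter, Finset.mem_univ, true_and]
  omega

/-- The members of the j-th contraction are the parts at level j + 1 of those members of `B` that
have maximum j + 1. Such a part is a singleton exactly when the maximizer is unique. -/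
theorem generic_iff_isDiscrete {B : BuildingSet V} {g : V → ℕ} {k : ℕ}
    (hg : ∀ i, 1 ≤ g i ∧ g i ≤ k) :
    B.Generic g ↔ ∀ j < k, IsDiscrete (contraction
      (restriction (B.sets : Set (Finset V)) (sublevel g (j + 1))) (sublevel g j)) := by
  constructor
  · rintro h j - J ⟨hne, hdisj, I', hI', hsub, hmem⟩
    obtain ⟨m, hmU, hm⟩ := h ⟨_, hmem⟩
    have hJ : ∀ i ∈ J, g i = j + 1 := by
      intro i hi
      have h1 := hsub (Finset.mem_union_right _ hi)
      have h2 := Finset.disjoint_left.1 hdisj hi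
      simp only [sublevel, Finset.mem_filter, Finset.mem_univ, true_and] at h1 h2
      omega
    have hm' : ∀ i ∈ J, i = m := by
      intro i hi
      by_contra hne
      have h1 := hm i (Finset.mem_union_right _ hi) hne
      rw [hJ i hi] at h1
      have h2 := hsub hmU
      simp only [sublevel, Finset.mem_filter, Finset.mem_univ, true_and] at h2
      omega
    obtain ⟨x, hx⟩ := hne
    exact Finset.card_eq_one.2 ⟨m, Finset.eq_singleton_iff_nonempty_unique_mem.2 ⟨⟨x, hx⟩, hm'⟩⟩
  · rintro h ⟨I, hI⟩
    obtain ⟨m, hm, hmax⟩ := I.exists_max_image g (B.nonempty_of_mem I hI)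
    obtain ⟨j, hj⟩ : ∃ j, g m = j + 1 := ⟨g m - 1, by have := hg m; omega⟩
    have hmem : I.filter (fun i => g i = j + 1) ∈ contraction
        (restriction (B.sets : Set (Finset V)) (sublevel g (j + 1))) (sublevel g j) := by
      refine ⟨⟨m, Finset.mem_filter.2 ⟨hm, hj⟩⟩, ?_, I.filter (fun i => g i ≤ j), ?_, ?_⟩
      · rw [Finset.disjoint_left]
        intro i hi hi'
        simp only [sublevel, Finset.mem_filter, Finset.mem_univ, true_and] at hi hi'
        omega
      · exact Finset.filter_subset_filter _ (Finset.subset_univ I)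
      · have hunion : I.filter (fun i => g i ≤ j) ∪ I.filter (fun i => g i = j + 1) = I := by
          ext i
          simp only [Finset.mem_union, Finset.mem_filter]
          constructor
          · tauto
          · intro hi
            have := hmax i hi
            have : g i ≤ j ∨ g i = j + 1 := by omega
            tauto
        rw [hunion]
        refine ⟨fun i hi => ?_, hI⟩
        simp only [sublevel, Finset.mem_filter, Finset.mem_univ, true_and]
        exact hj ▸ hmax i hi
    obtain ⟨x, hx⟩ := Finset.card_eq_one.1 (h j (by have := hg m; omega) _ hmem)
    refine ⟨m, hm, fun i hi hne => lt_of_le_of_ne (hmax i hi) fun heq => hne ?_⟩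
    have h1 : i ∈ I.filter (fun i => g i = j + 1) := Finset.mem_filter.2 ⟨hi, heq.trans hj⟩
    have h2 : m ∈ I.filter (fun i => g i = j + 1) := Finset.mem_filter.2 ⟨hm, hj⟩
    rw [hx, Finset.mem_singleton] at h1 h2
    rw [h1, h2]

/-- The generic functions with levels `1, …, k` whose cardinalities are given by `α`. -/
def genericOfType (B : BuildingSet V) {n : ℕ} (α : Composition n) : Set (V → ℕ) :=
  {g | B.Generic g ∧ (∀ i, 1 ≤ g i ∧ g i ≤ α.length) ∧
    ∀ j : Fin α.length, (level g (j + 1)).card = α.blocksFun j}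

/-- Splitting chains are the sublevel sets of generic functions. -/
theorem zeta_eq_ncard (B : BuildingSet V) {n : ℕ} (α : Composition n) :
    zeta B α = (genericOfType B α).ncard := by
  symm
  refine Set.ncard_congr (fun g _ (j : Fin (α.length + 1)) => sublevel g j) ?_ ?_ ?_
  · rintro g ⟨hgen, hg, hcard⟩
    refine ⟨?_, ?_, fun j => ?_, fun j => ?_, fun j => ?_⟩
    · refine Finset.filter_eq_empty_iff.2 fun i _ => ?_
      have := hg i
      simp only [Fin.val_zero]
      omega
    · exact Finset.filter_eq_self.2 fun i _ => (hg i).2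
    · intro i
      simp only [sublevel, Finset.mem_filter, Finset.mem_univ, true_and, Fin.val_castSucc,
        Fin.val_succ]
      omega
    · simp only [Fin.val_castSucc, Fin.val_succ]
      rw [sublevel_sdiff, hcard]
    · exact (generic_iff_isDiscrete hg).1 hgen j j.2
  · rintro g g' ⟨-, hg, -⟩ ⟨-, hg', -⟩ h
    have hle : ∀ i, ∀ j ≤ α.length, g i ≤ j ↔ g' i ≤ j := by
      intro i j hj
      have := Finset.ext_iff.1 (congrFun h ⟨j, Nat.lt_succ_of_le hj⟩) i
      simpa [sublevel] using this
    ext i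
    exact le_antisymm ((hle i _ (hg' i).2).2 le_rfl) ((hle i _ (hg i).2).1 le_rfl)
  · intro I hI
    have hmono : Monotone I := Fin.monotone_iff_le_succ.2 hI.subset
    -- The chain is increasing, so the indices with `i ∉ I j` form an initial segment; their number
    -- is the index at which `i` enters.
    let g : V → ℕ := fun i => (Finset.univ.filter fun j => i ∉ I j).card
    have hgI : ∀ i (j : Fin (α.length + 1)), g i ≤ (j : ℕ) ↔ i ∈ I j := by
      intro i j
      constructor
      · intro hle
        by_contra hi
        have hsub : Finset.Iic j ⊆ Finset.univ.filter fun j => i ∉ I j := fun j' hj' =>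
          Finset.mem_filter.2 ⟨Finset.mem_univ _, fun h => hi (hmono (Finset.mem_Iic.1 hj') h)⟩
        have := Finset.card_le_card hsub
        rw [Fin.card_Iic] at this
        exact absurd hle (by change ¬ (Finset.card _ ≤ _); omega)
      · intro hi
        have hsub : (Finset.univ.filter fun j => i ∉ I j) ⊆ Finset.Iio j := fun j' hj' =>
          Finset.mem_Iio.2 (lt_of_not_ge fun h => (Finset.mem_filter.1 hj').2 (hmono h hi))
        have := Finset.card_le_card hsub
        rwa [Fin.card_Iio] at this
    have hsub : ∀ j : Fin (α.length + 1), sublevel g j = I j := fun j => by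
      ext i
      rw [sublevel, Finset.mem_filter, hgI]
      simp
    have hg : ∀ i, 1 ≤ g i ∧ g i ≤ α.length := by
      intro i
      constructor
      · have h0 := (hgI i 0).not.2 (by simp [hI.first])
        simp only [Fin.val_zero] at h0
        omega
      · exact (hgI i (Fin.last _)).2 (by simp [hI.last])
    refine ⟨g, ⟨(generic_iff_isDiscrete hg).2 fun j hj => ?_, hg, fun j => ?_⟩, funext hsub⟩
    · have := hI.discrete ⟨j, hj⟩
      rwa [← hsub, ← hsub] at this
    · rw [← hI.card j, ← hsub, ← hsub, Fin.val_castSucc, Fin.val_succ, sublevel_sdiff]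

theorem image_eq_Icc_of_mem_genericOfType {B : BuildingSet V} {n : ℕ} {α : Composition n}
    {g : V → ℕ} (hg : g ∈ genericOfType B α) : Finset.univ.image g = Finset.Icc 1 α.length := by
  ext x
  simp only [Finset.mem_image, Finset.mem_univ, true_and, Finset.mem_Icc]
  constructor
  · rintro ⟨i, rfl⟩
    exact hg.2.1 i
  · rintro ⟨h1, h2⟩
    have hpos : 0 < (level g (x - 1 + 1)).card := by
      rw [hg.2.2 ⟨x - 1, by omega⟩]
      exact α.blocks_pos' _ _
    obtain ⟨i, hi⟩ := Finset.card_pos.1 hpos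
    have := (Finset.mem_filter.1 hi).2
    exact ⟨i, by omega⟩

/-- The composition formed by the cardinalities of the levels of a packed function. -/
theorem existsUnique_composition {B : BuildingSet V} {k : ℕ} {g : V → ℕ}
    (hg : g ∈ genericOnto B (Finset.Icc 1 k)) :
    ∃! α : Composition (Fintype.card V), α.length = k ∧ g ∈ genericOfType B α := by
  have hmem : ∀ i, 1 ≤ g i ∧ g i ≤ k := fun i => by
    have := Finset.mem_image_of_mem g (Finset.mem_univ i)
    rwa [hg.2, Finset.mem_Icc] at this
  let α : Composition (Fintype.card V) :=
    { blocks := List.ofFn fun j : Fin k => (level g (j + 1)).card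
      blocks_pos := by
        intro a ha
        obtain ⟨j, rfl⟩ := (List.mem_ofFn' _ _).1 ha
        have hj : (j : ℕ) + 1 ∈ Finset.univ.image g := by
          rw [hg.2, Finset.mem_Icc]
          omega
        obtain ⟨i, -, hi⟩ := Finset.mem_image.1 hj
        exact Finset.card_pos.2 ⟨i, Finset.mem_filter.2 ⟨Finset.mem_univ i, hi⟩⟩
      blocks_sum := by
        rw [List.sum_ofFn, Fin.sum_univ_eq_sum_range (fun j => (level g (j + 1)).card),
          -- The shift by one matches the levels 1, …, k with the block indices 0, …, k - 1.
          ← Finset.card_univ, Finset.card_eq_sum_card_fiberwise (f := fun i => g i - 1)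
            (t := Finset.range k)]
        · refine Finset.sum_congr rfl fun j _ => ?_
          congr 1
          ext i
          have := hmem i
          simp only [level, Finset.mem_filter, Finset.mem_univ, true_and]
          omega
        · intro i _
          have := hmem i
          simp only [Finset.coe_range, Set.mem_Iio]
          omega }
  have hlen : α.length = k := List.length_ofFn
  refine ⟨α, ⟨hlen, hg.1, fun i => by rw [hlen]; exact hmem i, fun j => ?_⟩, ?_⟩
  · simp [Composition.blocksFun, α]
  · rintro β ⟨hβ, hβg⟩
    refine Composition.ext (List.ext_getElem (hβ.trans hlen.symm) fun j h1 h2 => ?_)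
    have := hβg.2.2 ⟨j, h1⟩
    simp only [Composition.blocksFun, List.get_eq_getElem] at this
    simp [α, ← this]

theorem sum_zeta_eq_sum_packedCount (B : BuildingSet V) {n : ℕ} (hn : Fintype.card V = n) :
    ∑ α : Composition n, (-1 : ℚ) ^ α.length * (zeta B α : ℚ) =
      ∑ k ∈ Finset.range (n + 1), (-1 : ℚ) ^ k * (packedCount B k : ℚ) := by
  subst hn
  rw [← Finset.sum_fiberwise_of_maps_to (s := Finset.univ)
    (t := Finset.range (Fintype.card V + 1)) (g := Composition.length)
    fun α _ => Finset.mem_range.2 (Nat.lt_succ_of_le α.length_le)]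
  refine Finset.sum_congr rfl fun k _ => ?_
  rw [packedCount, ncard_eq_sum_of_existsUnique (genericOnto_finite B _)
    (Finset.univ.filter fun α : Composition (Fintype.card V) => α.length = k)
    (fun α g => g ∈ genericOfType B α)
    (fun g hg => by simpa using existsUnique_composition hg), Nat.cast_sum, Finset.mul_sum]
  refine Finset.sum_congr rfl fun α hα => ?_
  obtain rfl := (Finset.mem_filter.1 hα).2
  rw [zeta_eq_ncard]
  congr 3
  ext g
  exact ⟨fun h => ⟨⟨h.1, image_eq_Icc_of_mem_genericOfType h⟩, h⟩, fun h => h.2⟩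

end SplittingChain

/-! ### The polynomial χ and its value at -1 -/

section Specialization

variable {V : Type*} [Fintype V]

theorem mem_support_exponent {f : V → ℕ+} {x : ℕ+} : x ∈ (exponent f).support ↔ ∃ i, f i = x := by
  simp [exponent, Finsupp.single_apply]

theorem principalSpecialization_genericEnumerator (Q : Set (V → ℝ)) (m : ℕ) :
    principalSpecialization m (genericEnumerator Q) =
      ({f : V → ℕ+ | IsGeneric Q f ∧ ∀ i, (f i : ℕ) ≤ m}.ncard : ℚ) := by
  set s := {f : V → ℕ+ | IsGeneric Q f ∧ ∀ i, (f i : ℕ) ≤ m} with hs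
  have hfin : s.Finite := by
    have hm : {x : ℕ+ | (x : ℕ) ≤ m}.Finite :=
      (Set.finite_Iic m).preimage PNat.coe_injective.injOn
    exact (Set.Finite.pi' fun _ : V => hm).subset fun f hf => hf.2
  have hset : ∀ d : ℕ+ →₀ ℕ, (∀ i ∈ d.support, (i : ℕ) ≤ m) →
      {f : V → ℕ+ | IsGeneric Q f ∧ exponent f = d} = {f | f ∈ s ∧ exponent f = d} := by
    intro d hd
    ext f
    constructor
    · rintro ⟨h1, rfl⟩
      exact ⟨⟨h1, fun i => hd _ (mem_support_exponent.2 ⟨i, rfl⟩)⟩, rfl⟩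
    · rintro ⟨h1, h2⟩
      exact ⟨h1.1, h2⟩
  have hsupp : ∀ f ∈ s, ∀ i ∈ (exponent f).support, (i : ℕ) ≤ m := by
    intro f hf x hx
    obtain ⟨i, rfl⟩ := mem_support_exponent.1 hx
    exact hf.2 i
  classical
  have hcount := ncard_eq_sum_of_existsUnique hfin (hfin.toFinset.image exponent)
    (fun d f => exponent f = d) fun f hf => ⟨exponent f,
      ⟨Finset.mem_image_of_mem _ (by simpa using hf), rfl⟩, fun d hd => hd.2.symm⟩
  rw [hcount, Nat.cast_sum, principalSpecialization]
  have hcoeff : ∀ d, MvPowerSeries.coeff d (genericEnumerator Q) =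
      ({f : V → ℕ+ | IsGeneric Q f ∧ exponent f = d}.ncard : ℚ) := fun d => rfl
  have himg : ∀ d ∈ hfin.toFinset.image exponent, ∀ i ∈ d.support, (i : ℕ) ≤ m := by
    intro d hd
    obtain ⟨f, hf, rfl⟩ := Finset.mem_image.1 hd
    exact hsupp f (by simpa using hf)
  -- Only exponents of the finitely many generic functions bounded by m have a nonzero coefficient
  -- in the range of summation.
  rw [finsum_mem_eq_sum_of_inter_support_eq (t := hfin.toFinset.image exponent)]
  · exact Finset.sum_congr rfl fun d hd => by rw [hcoeff, hset d (himg d hd)]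
  · ext d
    simp only [Set.mem_inter_iff, Function.mem_support, Finset.mem_coe]
    refine ⟨fun ⟨hd, hne⟩ => ⟨?_, hne⟩, fun ⟨hd, hne⟩ => ⟨himg d hd, hne⟩⟩
    rw [hcoeff, hset d hd] at hne
    obtain ⟨f, hf, rfl⟩ := Set.nonempty_of_ncard_ne_zero (by exact_mod_cast hne)
    exact Finset.mem_image_of_mem _ (by simpa using hf)

theorem IsChiPolynomial.eq {Q : Set (V → ℝ)} {χ χ' : ℚ[X]} (h : IsChiPolynomial Q χ)
    (h' : IsChiPolynomial Q χ') : χ = χ' := by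
  refine eq_of_infinite_eval_eq χ χ' ((Set.infinite_range_of_injective
    (Nat.cast_injective (R := ℚ))).mono ?_)
  rintro _ ⟨m, rfl⟩
  exact (h m).trans (h' m).symm

variable [DecidableEq V]

/-- Sort by image: each k-subset of {1, …, m} is the image of equally many generic functions. -/
theorem ncard_isGeneric_le (B : BuildingSet V) (m : ℕ) :
    {f : V → ℕ+ | IsGeneric (nestohedron B) f ∧ ∀ i, (f i : ℕ) ≤ m}.ncard =
      ∑ k ∈ Finset.range (m + 1), m.choose k * packedCount B k := by
  have h1 : {f : V → ℕ+ | IsGeneric (nestohedron B) f ∧ ∀ i, (f i : ℕ) ≤ m}.ncard =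
      {g : V → ℕ | B.Generic g ∧ ∀ i, g i ∈ Finset.Icc 1 m}.ncard := by
    refine Set.ncard_congr (fun f _ i => (f i : ℕ)) ?_ ?_ ?_
    · rintro f ⟨hf, hm⟩
      exact ⟨generic_iff_exists_vertex.2 hf, fun i => Finset.mem_Icc.2 ⟨(f i).pos, hm i⟩⟩
    · intro f f' _ _ h
      funext i
      exact PNat.coe_injective (congrFun h i)
    · rintro g ⟨hg, hm⟩
      exact ⟨fun i => ⟨g i, (Finset.mem_Icc.1 (hm i)).1⟩,
        ⟨generic_iff_exists_vertex.1 hg, fun i => (Finset.mem_Icc.1 (hm i)).2⟩, rfl⟩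
  have hfin : {g : V → ℕ | B.Generic g ∧ ∀ i, g i ∈ Finset.Icc 1 m}.Finite :=
    (Set.Finite.pi' fun _ : V => (Finset.Icc 1 m).finite_toSet).subset fun g hg => hg.2
  rw [h1, ncard_eq_sum_of_existsUnique hfin (Finset.Icc 1 m).powerset
    (fun S g => Finset.univ.image g = S) fun g hg => ⟨Finset.univ.image g,
      ⟨Finset.mem_powerset.2 (Finset.image_subset_iff.2 fun i _ => hg.2 i), rfl⟩,
      fun S hS => hS.2.symm⟩]
  have h2 : ∀ S ∈ (Finset.Icc 1 m).powerset,
      {g | g ∈ {g : V → ℕ | B.Generic g ∧ ∀ i, g i ∈ Finset.Icc 1 m} ∧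
        Finset.univ.image g = S}.ncard = packedCount B S.card := by
    intro S hS
    rw [← genericOnto_ncard]
    congr 1
    ext g
    constructor
    · rintro ⟨⟨h3, -⟩, h4⟩
      exact ⟨h3, h4⟩
    · rintro ⟨h3, rfl⟩
      exact ⟨⟨h3, fun i => Finset.mem_powerset.1 hS
        (Finset.mem_image_of_mem g (Finset.mem_univ i))⟩, rfl⟩
  rw [Finset.sum_congr rfl h2, Finset.sum_powerset_apply_card (packedCount B)]
  simp

/-- The polynomial `∑ k, packedCount B k * (X choose k)`. -/
noncomputable def chiPolynomial (B : BuildingSet V) : ℚ[X] :=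
  ∑ k ∈ Finset.range (Fintype.card V + 1),
    C ((packedCount B k : ℚ) / k.factorial) * descPochhammer ℚ k

theorem isChiPolynomial_chiPolynomial (B : BuildingSet V) :
    IsChiPolynomial (nestohedron B) (chiPolynomial B) := by
  intro m
  rw [principalSpecialization_genericEnumerator, ncard_isGeneric_le, chiPolynomial,
    eval_finsetSum, Nat.cast_sum]
  have hterm : ∀ k, eval (m : ℚ) (C ((packedCount B k : ℚ) / k.factorial) * descPochhammer ℚ k) =
      ((m.choose k * packedCount B k : ℕ) : ℚ) := by
    intro k
    have hk : (k.factorial : ℚ) ≠ 0 := Nat.cast_ne_zero.2 k.factorial_ne_zero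
    rw [eval_mul, eval_C, descPochhammer_eval_eq_descFactorial,
      Nat.descFactorial_eq_factorial_mul_choose]
    push_cast
    field_simp
  simp only [hterm]
  -- Both sums extend to a common range: `packedCount B k` vanishes for k > |V|, and the binomial
  -- coefficient for k > m.
  rw [Finset.sum_subset (Finset.range_subset_range.2
      (by omega : Fintype.card V + 1 ≤ Fintype.card V + m + 1)),
    Finset.sum_subset (Finset.range_subset_range.2
      (by omega : m + 1 ≤ Fintype.card V + m + 1))]
  · intro k _ hk
    rw [Nat.choose_eq_zero_of_lt (by rw [Finset.mem_range] at hk; omega)]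
    simp
  · intro k _ hk
    rw [packedCount_eq_zero B (by rw [Finset.mem_range] at hk; omega)]
    simp

/-- This is the product (-1)(-2)⋯(-k), or binom(-1, k) = (-1)^k after division by k!. -/
theorem eval_neg_one_descPochhammer (k : ℕ) :
    (descPochhammer ℚ k).eval (-1) = (-1) ^ k * k.factorial := by
  induction k with
  | zero => simp
  | succ k ih =>
    rw [descPochhammer_succ_eval, ih, Nat.factorial_succ]
    push_cast
    ring

theorem eval_neg_one_chiPolynomial (B : BuildingSet V) :
    (chiPolynomial B).eval (-1) =
      ∑ k ∈ Finset.range (Fintype.card V + 1), (-1 : ℚ) ^ k * (packedCount B k : ℚ) := by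
  rw [chiPolynomial, eval_finsetSum]
  refine Finset.sum_congr rfl fun k _ => ?_
  have hk : (k.factorial : ℚ) ≠ 0 := Nat.cast_ne_zero.2 k.factorial_ne_zero
  rw [eval_mul, eval_C, eval_neg_one_descPochhammer]
  field_simp

end Specialization
end Nestohedra

theorem mainTheorem8 (n : ℕ) (B : Nestohedra.BuildingSet (Fin n)) :
    (∃! χ : ℚ[X], Nestohedra.IsChiPolynomial (Nestohedra.nestohedron B) χ) ∧
    ∀ χ : ℚ[X], Nestohedra.IsChiPolynomial (Nestohedra.nestohedron B) χ →
      χ.eval (-1) = ∑ α : Composition n, (-1 : ℚ) ^ α.length * (Nestohedra.zeta B α : ℚ) ∧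
      ∑ α : Composition n, (-1 : ℚ) ^ α.length * (Nestohedra.zeta B α : ℚ) =
        (-1 : ℚ) ^ n * ((Nestohedra.vertices (Nestohedra.nestohedron B)).ncard : ℚ) := by
  have hχ := Nestohedra.isChiPolynomial_chiPolynomial B
  have hzeta := Nestohedra.sum_zeta_eq_sum_packedCount B (Fintype.card_fin n)
  have hchi := Nestohedra.eval_neg_one_chiPolynomial B
  have hsum := Nestohedra.sum_packedCount B
  rw [Fintype.card_fin] at hchi hsum
  refine ⟨⟨_, hχ, fun χ h => h.eq hχ⟩, fun χ h => ⟨?_, hzeta.trans hsum⟩⟩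
  rw [h.eq hχ, hchi, hzeta]
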